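/- Every ordinal $\beta$ is identified with its set of predecessors $\{x : x<\beta\}$ and carries the order topology; ordinal arithmetic is used throughout, and $[X]^2$ is the set of two-element subsets of $X$. For ordinals $\alpha_0,\alpha_1,\beta$, write $\beta\to_{cl}(\alpha_0,\alpha_1)^2$ (respectively $\beta\to_{top}(\alpha_0,\alpha_1)^2$) if for every function $c:[\beta]^2\to\{0,1\}$ there are $i\in\{0,1\}$ and $X\subseteq\beta$ such that $c$ takes only the value $i$ on $[X]^2$ and $X$, with the subspace topology, admits a bijection onto $\alpha_i$ that is both an order-isomorphism and a homeomorphism (respectively, a homeomorphism). Let $R^{cl}(\alpha_0,\alpha_1)$ (respectively $R^{top}(\alpha_0,\alpha_1)$) be the least ordinal $\beta$, if there is one, such that $\beta\to_{cl}(\alpha_0,\alpha_1)^2$ (respectively $\beta\to_{top}(\alpha_0,\alpha_1)^2$). Then for every positive integer $k$, $$\omega^{\omega\cdot k}+1\to_{cl}(\omega^2+1,k+2)^2.$$ Moreover, $R^{top}(\omega^2+1,k+2)$ and $R^{cl}(\omega^2+1,k+2)$ exist, and $$R^{top}(\omega^2+1,k+2)=R^{cl}(\omega^2+1,k+2)\le\omega^{\omega\cdot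 k}+1.$$ -/

import Mathlib

open Ordinal Set

universe u

/-- The ordinal `β` is viewed as the set `Iio β` of its predecessors, a subspace of `Ordinal`
(this is the order topology of `β`), and `Set.powersetCard (Iio β) n` is `[β]^n`.
A set `X ⊆ β` is `i`-homogeneous for the coloring `c` if every `n`-element subset of `X` has
color `i`. -/
def IsHomogeneousFor {β : Ordinal.{u}} {n : ℕ} {ι : Type*}
    (c : Set.powersetCard (Iio β) n → ι) (i : ι) (X : Set (Iio β)) : Prop :=
  ∀ s : Set.powersetCard (Iio β) n, ((s : Finset (Iio β)) : Set (Iio β)) ⊆ X → c s = i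

/-- `X` is homeomorphic to the ordinal `α`. -/
def IsTopCopy {β : Ordinal.{u}} (X : Set (Iio β)) (α : Ordinal.{u}) : Prop :=
  Nonempty (X ≃ₜ Iio α)

/-- `X` is order-homeomorphic to the ordinal `α`: some bijection is both an order-isomorphism and
a homeomorphism. -/
def IsClosedCopy {β : Ordinal.{u}} (X : Set (Iio β)) (α : Ordinal.{u}) : Prop :=
  ∃ e : X ≃o Iio α, IsHomeomorph e

/-- The topological partition relation `β →_top (α_i)^n_{i ∈ ι}`. -/
def ArrowTop (β : Ordinal.{u}) (n : ℕ) {ι : Type*} (α : ι → Ordinal.{u}) : Prop :=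
  ∀ c : Set.powersetCard (Iio β) n → ι,
    ∃ (X : Set (Iio β)) (i : ι), IsHomogeneousFor c i X ∧ IsTopCopy X (α i)

/-- The closed partition relation `β →_cl (α_i)^n_{i ∈ ι}`. -/
def ArrowCl (β : Ordinal.{u}) (n : ℕ) {ι : Type*} (α : ι → Ordinal.{u}) : Prop :=
  ∀ c : Set.powersetCard (Iio β) n → ι,
    ∃ (X : Set (Iio β)) (i : ι), IsHomogeneousFor c i X ∧ IsClosedCopy X (α i)

/-- The topological ordinal Ramsey number: the least `β` with `β →_top (α_i)^2`
(only meaningful when such a `β` exists). -/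
noncomputable def topRamsey {ι : Type*} (α : ι → Ordinal.{u}) : Ordinal.{u} :=
  sInf {β | ArrowTop β 2 α}

/-- The closed ordinal Ramsey number: the least `β` with `β →_cl (α_i)^2`
(only meaningful when such a `β` exists). -/
noncomputable def closedRamsey {ι : Type*} (α : ι → Ordinal.{u}) : Ordinal.{u} :=
  sInf {β | ArrowCl β 2 α}

/-! Join two points when their pair has colour 1. The theorem reduces to a claim proved by induction
on K: a set with no K-clique and with a nonempty derivative of high enough rank contains an
independent set whose second derivative is nonempty. Rank 2 suffices for K = 2, and each further
clique vertex costs at most ω more ranks (`DerivRamsey.step`). Since ω^(ω·k) has rank ω·k in ω^(ω·k)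
+ 1, K = k + 2 is reached there.

For the inductive step, let p be a point of top rank and split the points below it into neighbours B
and non-neighbours R. If the γ-th derivative of B is nonempty, induction applies to B, because p
extends every clique in B. Otherwise `leftDeriv_pigeonhole` makes every finite derivative of R
accumulate at p. Coherent ultrafilters on points of each finite rank then describe generic points of
R with sequences converging to them. If generic points were joined, repeating the choice would
produce a large clique; so they are unjoined, and a countable generic construction
(`exists_homogeneous_of_goodThread`) gives an independent subset of R whose own limit points
accumulate at p. Adjoining p finishes the step.

A countable set with nonempty second derivative contains a closed copy of ω² + 1, and a homeomorphic
copy of ω² + 1 has nonempty second derivative. Hence the two partition relations agree. -/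

open Filter

/-! ### Derivatives by left limits, and a pigeonhole principle for ranks -/

section LeftDerivative

variable {L : Type*} [LinearOrder L]

/-- `x` is a limit from the left of points of `S`. -/
def IsLeftLim (S : Set L) (x : L) : Prop :=
  (∃ a, a < x) ∧ ∀ a < x, ∃ y ∈ S, a < y ∧ y < x

theorem IsLeftLim.mono {S T : Set L} {x : L} (h : IsLeftLim S x) (hST : S ⊆ T) : IsLeftLim T x :=
  ⟨h.1, fun a ha => (h.2 a ha).imp fun _ hy => ⟨hST hy.1, hy.2⟩⟩

/-- The `α`-th iterated derivative of `X`, with respect to limits from the left. -/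
def leftDeriv (X : Set L) (α : Ordinal.{u}) : Set L :=
  {x | x ∈ X ∧ ∀ β, ∀ _ : β < α, IsLeftLim (leftDeriv X β) x}
termination_by α

theorem mem_leftDeriv {X : Set L} {α : Ordinal.{u}} {x : L} :
    x ∈ leftDeriv X α ↔ x ∈ X ∧ ∀ β < α, IsLeftLim (leftDeriv X β) x := by
  rw [leftDeriv]; rfl

theorem leftDeriv_subset {X : Set L} {α : Ordinal.{u}} : leftDeriv X α ⊆ X :=
  fun _ h => (mem_leftDeriv.1 h).1

theorem leftDeriv_anti {X : Set L} {α β : Ordinal.{u}} (h : α ≤ β) :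
    leftDeriv X β ⊆ leftDeriv X α := fun _ hx =>
  mem_leftDeriv.2 ⟨leftDeriv_subset hx, fun γ hγ => (mem_leftDeriv.1 hx).2 γ (hγ.trans_le h)⟩

/-- Induction on the point. A point y of rank b + d in B that fails to have rank b in B is, near y,
free of points of some rank b' < b in B; the case b', d at y then leaves only points of rank d in R.
The case of y in R is symmetric. -/
theorem leftDeriv_pigeonhole [WellFoundedLT L] {X B R : Set L} (x : L) :
    ∀ (b : Ordinal.{u}) (d : ℕ), x ∈ leftDeriv X (b + d + 1) →
      (∀ y ∈ X, y < x → y ∈ B ∨ y ∈ R) → ∀ a < x,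
      ∃ y, a < y ∧ y < x ∧ (y ∈ leftDeriv B b ∨ y ∈ leftDeriv R (d : Ordinal.{u})) := by
  induction x using WellFoundedLT.induction with
  | _ x ih =>
  intro b d hx hX a ha
  by_contra! hcon
  obtain ⟨y, hy, hay, hyx⟩ := ((mem_leftDeriv.1 hx).2 (b + d) (lt_add_one _)).2 a ha
  have hX' : ∀ w ∈ X, w < y → w ∈ B ∨ w ∈ R := fun w hw hwy => hX w hw (hwy.trans hyx)
  obtain ⟨hB, hR⟩ := hcon y hay hyx
  rcases hX y (leftDeriv_subset hy) hyx with hyB | hyR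
  · rw [mem_leftDeriv] at hB
    simp only [IsLeftLim, not_and, not_forall] at hB
    obtain ⟨b', hb', hb⟩ := hB hyB
    obtain ⟨a', ha', hb⟩ := hb ⟨a, hay⟩
    push Not at hb
    -- Finiteness of d is used here: d + 1 = 1 + d lets the successor be absorbed into b' + 1 ≤ b.
    have hle : b' + d + 1 ≤ b + d := by
      rw [add_assoc, ← Nat.cast_succ, Nat.succ_eq_one_add, Nat.cast_add, ← add_assoc, Nat.cast_one]
      exact add_le_add_left (Order.add_one_le_of_lt hb') _
    obtain ⟨w, haw, hwy, hw⟩ := ih y hyx b' d (leftDeriv_anti hle hy) hX' (max a a')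
      (max_lt hay ha')
    rw [max_lt_iff] at haw
    rcases hw with hw | hw
    · exact absurd hwy (hb w hw haw.2).not_gt
    · exact (hcon w haw.1 (hwy.trans hyx)).2 hw
  · rw [mem_leftDeriv] at hR
    simp only [IsLeftLim, not_and, not_forall] at hR
    obtain ⟨e, he, hb⟩ := hR hyR
    obtain ⟨a', ha', hb⟩ := hb ⟨a, hay⟩
    push Not at hb
    obtain ⟨d', rfl⟩ := lt_omega0.1 (he.trans (natCast_lt_omega0 d))
    have hle : b + d' + 1 ≤ b + d := by
      rw [add_assoc]
      exact add_le_add_right (Order.add_one_le_of_lt he) _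
    obtain ⟨w, haw, hwy, hw⟩ := ih y hyx b d' (leftDeriv_anti hle hy) hX' (max a a')
      (max_lt hay ha')
    rw [max_lt_iff] at haw
    rcases hw with hw | hw
    · exact (hcon w haw.1 (hwy.trans hyx)).1 hw
    · exact absurd hwy (hb w hw haw.2).not_gt

end LeftDerivative

/-! ### Extracting finite cliques from ultrafilter quantifiers -/

section Generic

variable {L : Type*}

/-- Each new point is chosen generic for all earlier ones. It is put at the head, so the list runs
from latest to earliest, whence the swapped arguments of `R`. -/
theorem exists_list_pairwise_of_eventually {T : Type*} {Q : Filter T} [Q.NeBot] {S : Set T}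
    {R : T → T → Prop} (hS : ∀ᶠ x in Q, x ∈ S) (h : ∀ᶠ x in Q, ∀ᶠ y in Q, R x y) (m : ℕ) :
    ∃ l : List T, l.length = m ∧ l.Pairwise (fun a b => R b a) ∧
      ∀ x ∈ l, x ∈ S ∧ ∀ᶠ y in Q, R x y := by
  induction m with
  | zero => exact ⟨[], by simp⟩
  | succ m ih =>
    obtain ⟨l, hl, hp, hR⟩ := ih
    obtain ⟨x, hx, hx'⟩ := ((hS.and h).and
      ((eventually_all_finite l.finite_toSet).2 fun y hy => (hR y hy).2)).exists
    refine ⟨x :: l, by simp [hl], List.pairwise_cons.2 ⟨fun y hy => hx' y hy, hp⟩, ?_⟩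
    simp only [List.mem_cons, forall_eq_or_imp]
    exact ⟨hx, hR⟩

theorem exists_list_pairwise_of_ultrafilters {A : L → L → Prop} :
    ∀ (l : List (Ultrafilter L)) (S : Set L), (∀ U ∈ l, ∀ᶠ x in U, x ∈ S) →
      l.Pairwise (fun U V : Ultrafilter L => ∀ᶠ x in U, ∀ᶠ y in V, A x y) →
      ∃ l' : List L, l'.length = l.length ∧ l'.Pairwise A ∧ ∀ x ∈ l', x ∈ S
  | [], _, _, _ => ⟨[], by simp⟩
  | U :: l, S, hS, hl => by
    rw [List.pairwise_cons] at hl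
    obtain ⟨x, hx, hx'⟩ := ((hS U (by simp)).and
      ((eventually_all_finite l.finite_toSet).2 hl.1)).exists
    obtain ⟨l', h1, h2, h3⟩ := exists_list_pairwise_of_ultrafilters l (S ∩ {y | A x y})
      (fun V hV => (hS V (List.mem_cons_of_mem _ hV)).and (hx' V hV)) hl.2
    refine ⟨x :: l', by simp [h1], List.pairwise_cons.2 ⟨fun y hy => (h3 y hy).2, h2⟩, ?_⟩
    simp only [List.mem_cons, forall_eq_or_imp]
    exact ⟨hx, fun y hy => (h3 y hy).1⟩

/-- Descending through a coherent family of ultrafilters. -/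
theorem exists_list_pairwise_of_coherent {A : L → L → Prop} {Z : ℕ → L → ℕ → Ultrafilter L}
    (hZ : ∀ m t s x (φ : L → Prop), s < t → t < m →
      ((∀ᶠ y in Z m x t, ∀ᶠ z in Z t y s, φ z) ↔ ∀ᶠ z in Z m x s, φ z)) :
    ∀ (l : List ℕ) (Y : ℕ → Ultrafilter L) (S : Set L),
      (∀ t ∈ l, ∀ s ∈ l, ∀ φ : L → Prop, s < t →
        ((∀ᶠ y in Y t, ∀ᶠ z in Z t y s, φ z) ↔ ∀ᶠ z in Y s, φ z)) →
      (∀ a ∈ l, ∀ᶠ y in Y a, y ∈ S) →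
      l.Pairwise (fun a b => b < a ∧ ∀ᶠ y in Y a, ∀ᶠ z in Z a y b, A y z) →
      ∃ l' : List L, l'.length = l.length ∧ l'.Pairwise A ∧ ∀ x ∈ l', x ∈ S
  | [], _, _, _, _, _ => ⟨[], by simp⟩
  | a :: l, Y, S, hY, hS, hl => by
    rw [List.pairwise_cons] at hl
    have h1 : ∀ᶠ y in Y a, ∀ b ∈ l, ∀ᶠ z in Z a y b, A y z :=
      (eventually_all_finite l.finite_toSet).2 fun b hb => (hl.1 b hb).2
    have h2 : ∀ᶠ y in Y a, ∀ b ∈ l, ∀ᶠ z in Z a y b, z ∈ S :=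
      (eventually_all_finite l.finite_toSet).2 fun b hb =>
        (hY a List.mem_cons_self b (List.mem_cons_of_mem _ hb) _ (hl.1 b hb).1).2 (hS b (List.mem_cons_of_mem _ hb))
    -- Coherence passes the pairwise hypothesis from `Y` to `Z a y`, which plays the role of `Y` in
    -- the recursive call.
    have h3 : ∀ᶠ y in Y a, ∀ b ∈ l, ∀ c ∈ l, (∀ᶠ z in Y b, ∀ᶠ w in Z b z c, A z w) →
        ∀ᶠ z in Z a y b, ∀ᶠ w in Z b z c, A z w := by
      refine (eventually_all_finite l.finite_toSet).2 fun b hb =>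
        (eventually_all_finite l.finite_toSet).2 fun c hc => ?_
      by_cases h : ∀ᶠ z in Y b, ∀ᶠ w in Z b z c, A z w
      · filter_upwards [(hY a List.mem_cons_self b (List.mem_cons_of_mem _ hb) _ (hl.1 b hb).1).2 h] with y hy _ using hy
      · exact Eventually.of_forall fun y hy => absurd hy h
    obtain ⟨x, hx, hx1, hx2, hx3⟩ := ((hS a (by simp)).and (h1.and (h2.and h3))).exists
    obtain ⟨l', k1, k2, k3⟩ := exists_list_pairwise_of_coherent hZ l (Z a x) (S ∩ {y | A x y})
      (fun t ht s _ φ hst => hZ a t s x φ hst (hl.1 t ht).1)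
      (fun b hb => (hx2 b hb).and (hx1 b hb))
      (hl.2.imp_of_mem fun hb hc h => ⟨h.1, hx3 _ hb _ hc h.2⟩)
    refine ⟨x :: l', by simp [k1], List.pairwise_cons.2 ⟨fun y hy => (k3 y hy).2, k2⟩, ?_⟩
    simp only [List.mem_cons, forall_eq_or_imp]
    exact ⟨hx, fun y hy => (k3 y hy).1⟩

end Generic

/-! ### Generic construction of a homogeneous set from threads -/

section Thread

variable {L : Type*} [LinearOrder L]

/-- A point of a thread that is compatible with generic further threads. -/
structure IsGoodPoint (r : L → L → Prop) (R : Set L) (Q : Ultrafilter (L × Ultrafilter L)) (x : L) :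
    Prop where
  mem : x ∈ R
  fst : ∀ᶠ t : L × Ultrafilter L in Q, r x t.1
  snd : ∀ᶠ t : L × Ultrafilter L in Q, ∀ᶠ z in t.2, r x z

/-- A thread, consisting of a point `t.1` and an ultrafilter `t.2` converging to it, that is
compatible with itself and with generic further threads. -/
structure IsGoodThread (r : L → L → Prop) (R : Set L) (Q : Ultrafilter (L × Ultrafilter L))
    (t : L × Ultrafilter L) : Prop where
  point : IsGoodPoint r R Q t.1
  points : ∀ᶠ z in t.2, IsGoodPoint r R Q z
  fst_snd : ∀ᶠ z in t.2, r t.1 z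
  snd_snd : ∀ᶠ z in t.2, ∀ᶠ z' in t.2, r z z'
  cross_fst : ∀ᶠ t' : L × Ultrafilter L in Q, ∀ᶠ z in t.2, r t'.1 z
  cross : ∀ᶠ t' : L × Ultrafilter L in Q, ∀ᶠ z in t.2, ∀ᶠ z' in t'.2, r z z'
  cross' : ∀ᶠ t' : L × Ultrafilter L in Q, ∀ᶠ z' in t'.2, ∀ᶠ z in t.2, r z z'
  lim : ∀ a < t.1, ∀ᶠ z in t.2, a < z ∧ z < t.1

/-- A finite approximation of a homogeneous set: threads `s.1` and points `s.2`. -/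
structure IsApprox (r : L → L → Prop) (R : Set L) (Q : Ultrafilter (L × Ultrafilter L))
    (s : Set (L × Ultrafilter L) × Set L) : Prop where
  finite_fst : s.1.Finite
  finite_snd : s.2.Finite
  thread : ∀ t ∈ s.1, IsGoodThread r R Q t
  point : ∀ x ∈ s.2, IsGoodPoint r R Q x
  rel : ∀ x ∈ s.2, ∀ y ∈ s.2, x ≠ y → r x y
  point_thread : ∀ x ∈ s.2, ∀ t ∈ s.1, ∀ᶠ z in t.2, r x z
  thread_thread : ∀ t ∈ s.1, ∀ t' ∈ s.1, ∀ᶠ z in t.2, ∀ᶠ z' in t'.2, r z z'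

variable {r : L → L → Prop} {R : Set L} {Q : Ultrafilter (L × Ultrafilter L)}
  {s : Set (L × Ultrafilter L) × Set L}

theorem IsApprox.insert_point (hr : ∀ x y, r x y → r y x) (hs : IsApprox r R Q s)
    {t : L × Ultrafilter L} (ht : t ∈ s.1) :
    ∀ᶠ z in t.2, IsApprox r R Q (s.1, insert z s.2) := by
  filter_upwards [(hs.thread t ht).points,
    (eventually_all_finite hs.finite_snd).2 fun x hx => hs.point_thread x hx t ht,
    (eventually_all_finite hs.finite_fst).2 fun t' ht' => hs.thread_thread t ht t' ht']
    with z h1 h2 h3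
  refine ⟨hs.finite_fst, hs.finite_snd.insert z, hs.thread, ?_, ?_, ?_, hs.thread_thread⟩
  · rintro x (rfl | hx)
    exacts [h1, hs.point x hx]
  · rintro x (rfl | hx) y (rfl | hy) hxy
    exacts [absurd rfl hxy, hr _ _ (h2 y hy), h2 x hx, hs.rel x hx y hy hxy]
  · rintro x (rfl | hx) t' ht'
    exacts [h3 t' ht', hs.point_thread x hx t' ht']

theorem IsApprox.insert_thread (hr : ∀ x y, r x y → r y x) (hQ : ∀ᶠ t in Q, IsGoodThread r R Q t)
    (hs : IsApprox r R Q s) :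
    ∀ᶠ t in Q, IsApprox r R Q (insert t s.1, insert t.1 s.2) := by
  filter_upwards [hQ,
    (eventually_all_finite hs.finite_snd).2 fun x hx => (hs.point x hx).fst,
    (eventually_all_finite hs.finite_snd).2 fun x hx => (hs.point x hx).snd,
    (eventually_all_finite hs.finite_fst).2 fun t ht => (hs.thread t ht).cross_fst,
    (eventually_all_finite hs.finite_fst).2 fun t ht => (hs.thread t ht).cross,
    (eventually_all_finite hs.finite_fst).2 fun t ht => (hs.thread t ht).cross']
    with t h1 h2 h3 h4 h5 h6
  refine ⟨hs.finite_fst.insert t, hs.finite_snd.insert t.1, ?_, ?_, ?_, ?_, ?_⟩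
  · rintro t' (rfl | ht')
    exacts [h1, hs.thread t' ht']
  · rintro x (rfl | hx)
    exacts [h1.point, hs.point x hx]
  · rintro x (rfl | hx) y (rfl | hy) hxy
    exacts [absurd rfl hxy, hr _ _ (h2 y hy), h2 x hx, hs.rel x hx y hy hxy]
  · rintro x (rfl | hx) t' (rfl | ht')
    exacts [h1.fst_snd, h4 t' ht', h3 x hx, hs.point_thread x hx t' ht']
  · rintro t₁ (rfl | h₁) t₂ (rfl | h₂)
    · exact h1.snd_snd
    · filter_upwards [h6 t₂ h₂] with z hz
      filter_upwards [hz] with z' hz' using hr _ _ hz'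
    · exact h5 t₁ h₁
    · exact hs.thread_thread t₁ h₁ t₂ h₂

/-- A Rasiowa–Sikorski argument: approximations are ordered by inclusion, and an ideal meeting
countably many cofinal sets is taken. These sets ask for thread heads arbitrarily close to p, and
for points arbitrarily close below each head. -/
theorem exists_homogeneous_of_goodThread [Countable L] (hr : ∀ x y, r x y → r y x)
    (hQ : ∀ᶠ t in Q, IsGoodThread r R Q t) {p : L}
    (hp : ∀ a < p, ∀ᶠ t : L × Ultrafilter L in Q, a < t.1 ∧ t.1 < p) :
    ∃ X ⊆ R, (∀ x ∈ X, ∀ y ∈ X, x ≠ y → r x y) ∧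
      ∀ a < p, ∃ y ∈ X, IsLeftLim X y ∧ a < y ∧ y < p := by
  classical
  let P := {s : Set (L × Ultrafilter L) × Set L // IsApprox r R Q s}
  have hcof1 : ∀ a : Iio p, IsCofinal {s : P | ∃ t ∈ s.1.1, t.1 ∈ s.1.2 ∧ a < t.1 ∧ t.1 < p} := by
    rintro ⟨a, ha⟩ ⟨s, hs⟩
    obtain ⟨t, ht1, ht2⟩ := ((hs.insert_thread hr hQ).and (hp a ha)).exists
    exact ⟨⟨_, ht1⟩, ⟨t, mem_insert _ _, mem_insert _ _, ht2⟩,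
      ⟨subset_insert _ _, subset_insert _ _⟩⟩
  -- The second alternative makes the set cofinal for every pair: either some extension has a thread
  -- at `q.2`, which supplies a point, or none ever will.
  have hcof2 : ∀ q : L × L, IsCofinal {s : P | (∃ z ∈ s.1.2, q.1 < z ∧ z < q.2) ∨
      ∀ s' : P, s ≤ s' → ∀ t ∈ s'.1.1, t.1 = q.2 → ¬ q.1 < q.2} := by
    rintro ⟨b, y⟩ s
    by_cases h : ∀ s' : P, s ≤ s' → ∀ t ∈ s'.1.1, t.1 = y → ¬ b < y
    · exact ⟨s, Or.inr h, le_rfl⟩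
    · push Not at h
      obtain ⟨⟨s', hs'⟩, hle, t, ht, rfl, hb⟩ := h
      obtain ⟨z, hz1, hz2⟩ := ((hs'.insert_point hr ht).and ((hs'.thread t ht).lim b hb)).exists
      exact ⟨⟨_, hz1⟩, Or.inl ⟨z, mem_insert _ _, hz2⟩,
        hle.trans ⟨subset_rfl, subset_insert _ _⟩⟩
  have s₀ : P := ⟨(∅, ∅), by constructor <;> simp⟩
  let D : (Iio p ⊕ L × L) → Order.Cofinal P :=
    Sum.elim (fun a => ⟨_, hcof1 a⟩) (fun q => ⟨_, hcof2 q⟩)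
  have := Encodable.ofCountable (Iio p ⊕ L × L)
  let I := Order.idealOfCofinals s₀ D
  refine ⟨{x | ∃ s ∈ I, x ∈ s.1.2}, ?_, ?_, ?_⟩
  · rintro x ⟨s, -, hx⟩
    exact (s.2.point x hx).mem
  · rintro x ⟨s, hs, hx⟩ y ⟨s', hs', hy⟩ hxy
    obtain ⟨w, -, h1, h2⟩ := I.directed s hs s' hs'
    exact w.2.rel x (h1.2 hx) y (h2.2 hy) hxy
  · intro a ha
    obtain ⟨s, ⟨t, ht, ht1, ht2, ht3⟩, hs⟩ :=
      Order.cofinal_meets_idealOfCofinals s₀ D (Sum.inl ⟨a, ha⟩)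
    refine ⟨t.1, ⟨s, hs, ht1⟩, ⟨⟨a, ht2⟩, fun b hb => ?_⟩, ht2, ht3⟩
    obtain ⟨s', h, hs'⟩ := Order.cofinal_meets_idealOfCofinals s₀ D (Sum.inr (b, t.1))
    rcases h with ⟨z, hz, hz'⟩ | h
    · exact ⟨z, ⟨s', hs', hz⟩, hz'⟩
    · obtain ⟨w, -, h1, h2⟩ := I.directed s hs s' hs'
      exact absurd hb (h w h2 t (h1.1 ht) rfl)

end Thread

/-! ### Coherent ultrafilters on points of finite rank -/

section Coherent

variable {L : Type*}

/-- Given ultrafilters `C m x` on the points of rank `m` converging to `x`, the ultrafilter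
`descend C m x s` of generic points of rank `s` below the point `x` of rank `m`. -/
noncomputable def descend (C : ℕ → L → Ultrafilter L) : ℕ → L → ℕ → Ultrafilter L
  | 0, x, _ => pure x
  | m + 1, x, s => if s = m then C m x else (C m x).bind fun y => descend C m y s

variable {C : ℕ → L → Ultrafilter L}

theorem eventually_ultrafilter_bind {S T : Type*} {f : Ultrafilter S} {m : S → Ultrafilter T}
    {φ : T → Prop} : (∀ᶠ y in f.bind m, φ y) ↔ ∀ᶠ x in f, ∀ᶠ y in m x, φ y :=
  Filter.eventually_bind

theorem eventually_ultrafilter_map {S T : Type*} {f : Ultrafilter S} {m : S → T}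
    {φ : T → Prop} : (∀ᶠ y in f.map m, φ y) ↔ ∀ᶠ x in f, φ (m x) :=
  Iff.rfl

/-- Descent goes one rank at a time, so the path from rank m to rank s passes through rank t. -/
theorem eventually_descend_descend (C : ℕ → L → Ultrafilter L) (m t s : ℕ) (x : L) (φ : L → Prop)
    (hst : s < t) (htm : t < m) :
    (∀ᶠ y in descend C m x t, ∀ᶠ z in descend C t y s, φ z) ↔ ∀ᶠ z in descend C m x s, φ z := by
  induction m generalizing x with
  | zero => omega
  | succ m ih =>
    have hs : s ≠ m := by omega
    rw [descend, descend, if_neg hs]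
    split_ifs with h
    · subst h
      rw [eventually_ultrafilter_bind]
    · rw [eventually_ultrafilter_bind, eventually_ultrafilter_bind]
      exact eventually_congr (Eventually.of_forall fun y => ih y (by omega))

theorem eventually_descend_mem [LinearOrder L] {D : ℕ → Set L}
    (hC : ∀ m, ∀ x ∈ D (m + 1), ∀ a < x, ∀ᶠ y in C m x, y ∈ D m ∧ a < y ∧ y < x)
    {m : ℕ} {x : L} (hx : x ∈ D m) {s : ℕ} (hs : s < m) {a : L} (ha : a < x) :
    ∀ᶠ y in descend C m x s, y ∈ D s ∧ a < y ∧ y < x := by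
  induction m generalizing x with
  | zero => omega
  | succ m ih =>
    rw [descend]
    split_ifs with h
    · subst h
      exact hC _ x hx a ha
    · rw [eventually_ultrafilter_bind]
      filter_upwards [hC m x hx a ha] with y hy
      filter_upwards [ih hy.1 (by omega) hy.2.1] with z hz
      exact ⟨hz.1, hz.2.1, hz.2.2.trans hy.2.2⟩

theorem exists_ultrafilter_of_isLeftLim [LinearOrder L] {S : Set L} {x : L} (h : IsLeftLim S x) :
    ∃ U : Ultrafilter L, ∀ a < x, ∀ᶠ y in U, y ∈ S ∧ a < y ∧ y < x := by
  obtain ⟨⟨a₀, ha₀⟩, h⟩ := h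
  have : Nonempty (Iio x) := ⟨⟨a₀, ha₀⟩⟩
  have hne : (⨅ a : Iio x, 𝓟 {y | y ∈ S ∧ a.1 < y ∧ y < x}).NeBot := by
    refine iInf_neBot_of_directed' ?_ fun a => ?_
    · rintro ⟨a, ha⟩ ⟨b, hb⟩
      refine ⟨⟨max a b, max_lt ha hb⟩, ?_, ?_⟩ <;>
      · simp only [ge_iff_le, principal_mono, ofPred_subset_ofPred, max_lt_iff]
        tauto
    · obtain ⟨y, hy⟩ := h a.1 a.2
      exact principal_neBot_iff.2 ⟨y, hy⟩
  refine ⟨@Ultrafilter.of _ _ hne, fun a ha => @Ultrafilter.of_le _ _ hne _ ?_⟩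
  exact mem_iInf_of_mem (⟨a, ha⟩ : Iio x) (mem_principal_self _)

end Coherent

/-! ### An independent set with limit points accumulating at p -/

section Core

variable {L : Type*} [LinearOrder L]

theorem exists_homogeneous_of_coherent [Countable L] {A : L → L → Prop}
    (hA : ∀ x y, A x y → A y x) {R : Set L} {K : ℕ}
    (hK : ∀ l : List L, (∀ x ∈ l, x ∈ R) → l.Pairwise A → l.length ≠ K)
    {D : ℕ → Set L} (hD : ∀ n, D n ⊆ R) {Z : ℕ → L → ℕ → Ultrafilter L}
    (hZ : ∀ m t s x (φ : L → Prop), s < t → t < m →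
      ((∀ᶠ y in Z m x t, ∀ᶠ z in Z t y s, φ z) ↔ ∀ᶠ z in Z m x s, φ z))
    (hZD : ∀ m, ∀ x ∈ D m, ∀ s < m, ∀ a < x, ∀ᶠ y in Z m x s, a < y ∧ y < x)
    {Y : ℕ → Ultrafilter L} (hY : ∀ t s (φ : L → Prop), s < t →
      ((∀ᶠ y in Y t, ∀ᶠ z in Z t y s, φ z) ↔ ∀ᶠ z in Y s, φ z))
    {p a₀ : L} (ha₀ : a₀ < p) (hYD : ∀ s, ∀ a < p, ∀ᶠ y in Y s, y ∈ D s ∧ a < y ∧ y < p) :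
    ∃ X ⊆ R, (∀ x ∈ X, ∀ y ∈ X, x ≠ y → ¬ A x y) ∧
      ∀ a < p, ∃ y ∈ X, IsLeftLim X y ∧ a < y ∧ y < p := by
  obtain ⟨E, hE⟩ : ∃ E : Ultrafilter ℕ, ∀ n : ℕ, ∀ᶠ m in E, n < m :=
    ⟨hyperfilter ℕ, fun n => Nat.hyperfilter_le_atTop (eventually_gt_atTop n)⟩
  -- A generic thread: a rank b, then a much larger rank a, a head y of rank a near p, and the
  -- points of rank b converging to y.
  obtain ⟨Q, hQ⟩ : ∃ Q : Ultrafilter (L × Ultrafilter L), ∀ φ : L × Ultrafilter L → Prop,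
      (∀ᶠ t in Q, φ t) ↔ ∀ᶠ b in E, ∀ᶠ a in E, ∀ᶠ y in Y a, φ (y, Z a y b) :=
    ⟨E.bind fun b => E.bind fun a => (Y a).map fun y => (y, Z a y b), fun φ => by
      simp only [eventually_ultrafilter_bind, eventually_ultrafilter_map]⟩
  obtain ⟨W, hW⟩ : ∃ W : Ultrafilter L, ∀ φ : L → Prop,
      (∀ᶠ x in W, φ x) ↔ ∀ᶠ a in E, ∀ᶠ x in Y a, φ x :=
    ⟨E.bind Y, fun φ => eventually_ultrafilter_bind⟩
  have hQ1 : ∀ φ : L → Prop, (∀ᶠ t : L × Ultrafilter L in Q, φ t.1) ↔ ∀ᶠ x in W, φ x := fun φ =>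
    (hQ _).trans (eventually_const.trans (hW φ).symm)
  -- By coherence, the tail points of a generic thread are distributed by `W`, exactly as the heads
  -- are.
  have hQ2 : ∀ φ : L → Prop, (∀ᶠ t : L × Ultrafilter L in Q, ∀ᶠ z in t.2, φ z) ↔ ∀ᶠ x in W, φ x := fun φ => by
    rw [hQ, hW]
    refine eventually_congr (Eventually.of_forall fun b => ?_)
    rw [← eventually_const (f := (E : Filter ℕ)) (p := ∀ᶠ y in Y b, φ y)]
    refine eventually_congr ?_
    filter_upwards [hE b] with a ha using hY a b φ ha
  have hYR : ∀ s, ∀ᶠ y in Y s, y ∈ R := fun s => (hYD s a₀ ha₀).mono fun y hy => hD s hy.1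
  have hWR : ∀ᶠ x in W, x ∈ R :=
    (hW _).2 (Eventually.of_forall hYR)
  have hQR := (hQ2 _).2 hWR
  have f1 : ∀ᶠ x in W, ∀ᶠ y in W, ¬ A x y := by
    by_contra h
    simp only [← Ultrafilter.eventually_not, not_not] at h
    obtain ⟨l, hl, hp, hR⟩ := exists_list_pairwise_of_eventually hWR h K
    exact hK l (fun x hx => (hR x hx).1) (hp.imp fun h => hA _ _ h) hl
  -- Head and tail are not independent choices, so failure is exploited along one descending chain
  -- of K ranks: coherence makes the points met on the way down pairwise joined.
  have f2 : ∀ᶠ t : L × Ultrafilter L in Q, ∀ᶠ z in t.2, ¬ A t.1 z := by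
    by_contra h
    simp only [← Ultrafilter.eventually_not, not_not] at h
    rw [hQ] at h
    have h' : ∀ᶠ b in E, ∀ᶠ a in E, b < a ∧ ∀ᶠ y in Y a, ∀ᶠ z in Z a y b, A y z := by
      filter_upwards [h] with b hb
      exact (hE b).and hb
    obtain ⟨l, hl, hp, -⟩ :=
      exists_list_pairwise_of_eventually (S := univ) (Eventually.of_forall fun _ => trivial) h' K
    obtain ⟨l', hl', hp', hR⟩ := exists_list_pairwise_of_coherent hZ l Y R
      (fun t _ s _ φ hst => hY t s φ hst) (fun a _ => hYR a) hp
    exact hK l' hR hp' (hl'.trans hl)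
  have f3 : ∀ᶠ t : L × Ultrafilter L in Q, ∀ᶠ t' : L × Ultrafilter L in Q,
      ∀ᶠ z in t.2, ∀ᶠ z' in t'.2, ¬ A z z' := by
    by_contra h
    simp only [← Ultrafilter.eventually_not, not_not] at h
    obtain ⟨l, hl, hp, hR⟩ :=
      exists_list_pairwise_of_eventually (S := {t | ∀ᶠ z in t.2, z ∈ R}) hQR h K
    obtain ⟨l', hl', hp', hR'⟩ := exists_list_pairwise_of_ultrafilters (A := A)
      (l.map Prod.snd).reverse R (by
        simp only [List.mem_reverse, List.mem_map]
        rintro U ⟨t, ht, rfl⟩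
        exact (hR t ht).1) (by
        rw [List.pairwise_reverse, List.pairwise_map]
        exact hp)
    exact hK l' hR' hp' (by simpa [hl] using hl')
  have f4 : ∀ᶠ t : L × Ultrafilter L in Q, ∀ᶠ t' : L × Ultrafilter L in Q,
      ∀ᶠ z' in t'.2, ∀ᶠ z in t.2, ¬ A z z' := by
    by_contra h
    simp only [← Ultrafilter.eventually_not, not_not] at h
    obtain ⟨l, hl, hp, hR⟩ :=
      exists_list_pairwise_of_eventually (S := {t | ∀ᶠ z in t.2, z ∈ R}) hQR h K
    obtain ⟨l', hl', hp', hR'⟩ := exists_list_pairwise_of_ultrafilters (A := fun x y => A y x)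
      (l.map Prod.snd) R (by
        simp only [List.mem_map]
        rintro U ⟨t, ht, rfl⟩
        exact (hR t ht).1) (by
        rw [List.pairwise_map]
        exact hp)
    exact hK l' hR' (hp'.imp fun h => hA _ _ h) (by simpa [hl] using hl')
  have f5 : ∀ᶠ t : L × Ultrafilter L in Q, ∀ᶠ z in t.2, ∀ᶠ z' in t.2, ¬ A z z' := by
    filter_upwards [hQR] with t ht
    by_contra h
    simp only [← Ultrafilter.eventually_not, not_not] at h
    obtain ⟨l, hl, hp, hR⟩ := exists_list_pairwise_of_eventually ht h K
    exact hK l (fun x hx => (hR x hx).1) (hp.imp fun h => hA _ _ h) hl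
  have hgood : ∀ᶠ x in W, IsGoodPoint (fun x y => ¬ A x y) R Q x :=
    (hWR.and f1).mono fun x hx => ⟨hx.1, (hQ1 fun y => ¬ A x y).2 hx.2, (hQ2 fun y => ¬ A x y).2 hx.2⟩
  have hlim : ∀ᶠ t : L × Ultrafilter L in Q, ∀ a < t.1, ∀ᶠ z in t.2, a < z ∧ z < t.1 := by
    rw [hQ]
    refine Eventually.of_forall fun b => ?_
    filter_upwards [hE b] with a hba
    filter_upwards [hYD a a₀ ha₀] with y hy c hc
    exact hZD a y hy.1 b hba c hc
  refine exists_homogeneous_of_goodThread (Q := Q) (r := fun x y => ¬ A x y)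
    (fun x y h h' => h (hA _ _ h')) ?_ ?_
  · filter_upwards [(hQ1 fun x => IsGoodPoint _ R Q x).2 hgood,
      (hQ2 fun x => IsGoodPoint _ R Q x).2 hgood, f2, f3, f4, f5, hlim]
      with t h1 h2 h3 h4 h5 h6 h7
    refine ⟨h1, h2, h3, h6, ?_, h4, h5, h7⟩
    -- Heads and tail points of a generic thread share the law `W`, so `h5`, about tail points of
    -- t', also gives the statement about its head.
    exact (hQ1 fun x => ∀ᶠ z in t.2, ¬ A x z).2
      (((hQ2 fun x => ∀ᶠ z in t.2, ¬ A z x).1 h5).mono fun x hx =>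
        hx.mono fun z hz h => hz (hA _ _ h))
  · intro a ha
    rw [hQ1 fun x => a < x ∧ x < p]
    exact (hW _).2
      (Eventually.of_forall fun s => (hYD s a ha).mono fun y hy => hy.2)

/-- Supplies the ultrafilters: points near p of generic finite rank n are chosen first, and descent
from them gives generic points of each fixed rank s, coherently. -/
theorem exists_homogeneous_of_isLeftLim [Countable L] {A : L → L → Prop}
    (hA : ∀ x y, A x y → A y x) {R : Set L} {K : ℕ}
    (hK : ∀ l : List L, (∀ x ∈ l, x ∈ R) → l.Pairwise A → l.length ≠ K)
    {p : L} (hp : ∀ n : ℕ, IsLeftLim (leftDeriv R (n : Ordinal.{u})) p) :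
    ∃ X ⊆ R, (∀ x ∈ X, ∀ y ∈ X, x ≠ y → ¬ A x y) ∧
      ∀ a < p, ∃ y ∈ X, IsLeftLim X y ∧ a < y ∧ y < p := by
  let D : ℕ → Set L := fun n => leftDeriv R (n : Ordinal.{u})
  have hD : ∀ n, D n ⊆ R := fun n => leftDeriv_subset
  have hex : ∀ m x, ∃ U : Ultrafilter L,
      IsLeftLim (D m) x → ∀ a < x, ∀ᶠ y in U, y ∈ D m ∧ a < y ∧ y < x := by
    intro m x
    by_cases h : IsLeftLim (D m) x
    · exact (exists_ultrafilter_of_isLeftLim h).imp fun U hU _ => hU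
    -- A dummy value, away from left limits.
    · exact ⟨pure x, fun h' => absurd h' h⟩
  choose C hC using hex
  have hC' : ∀ m, ∀ x ∈ D (m + 1), ∀ a < x, ∀ᶠ y in C m x, y ∈ D m ∧ a < y ∧ y < x :=
    fun m x hx => hC m x ((mem_leftDeriv.1 hx).2 m (by exact_mod_cast Nat.lt_succ_self m))
  obtain ⟨E, hE⟩ : ∃ E : Ultrafilter ℕ, ∀ n : ℕ, ∀ᶠ m in E, n < m :=
    ⟨hyperfilter ℕ, fun n => Nat.hyperfilter_le_atTop (eventually_gt_atTop n)⟩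
  let Z := descend C
  have hZ := eventually_descend_descend C
  let Y : ℕ → Ultrafilter L := fun s => E.bind fun n => (C n p).bind fun x => Z n x s
  have hY : ∀ t s (φ : L → Prop), s < t →
      ((∀ᶠ y in Y t, ∀ᶠ z in Z t y s, φ z) ↔ ∀ᶠ z in Y s, φ z) := by
    intro t s φ hst
    simp only [Y, eventually_ultrafilter_bind]
    refine eventually_congr ?_
    filter_upwards [hE t] with n hn
    exact eventually_congr (Eventually.of_forall fun x => hZ n t s x φ hst hn)
  have hYD : ∀ s, ∀ a < p, ∀ᶠ y in Y s, y ∈ D s ∧ a < y ∧ y < p := by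
    intro s a ha
    simp only [Y, eventually_ultrafilter_bind]
    filter_upwards [hE s] with n hn
    filter_upwards [hC n p (hp n) a ha] with x hx
    filter_upwards [eventually_descend_mem hC' hx.1 hn hx.2.1] with y hy
    exact ⟨hy.1, hy.2.1, hy.2.2.trans hx.2.2⟩
  exact exists_homogeneous_of_coherent hA hK hD hZ
    (fun m x hx s hs a ha => (eventually_descend_mem hC' hx hs ha).mono fun y hy => hy.2)
    hY (hp 0).1.choose_spec hYD

end Core

/-! ### Induction on the clique size -/

section Induction

variable {L : Type*} [LinearOrder L]

theorem leftDeriv_zero (X : Set L) : leftDeriv X (0 : Ordinal.{u}) = X := by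
  ext x
  rw [mem_leftDeriv]
  exact ⟨fun h => h.1, fun h => ⟨h, fun β hβ => absurd hβ not_lt_zero⟩⟩

theorem mem_leftDeriv_add_one {X : Set L} {α : Ordinal.{u}} {x : L} :
    x ∈ leftDeriv X (α + 1) ↔ x ∈ X ∧ IsLeftLim (leftDeriv X α) x := by
  rw [mem_leftDeriv]
  refine and_congr_right fun _ => ⟨fun h => h α (lt_add_one α), fun h β hβ => ?_⟩
  exact h.mono (leftDeriv_anti (Order.lt_add_one_iff.1 hβ))

theorem mem_leftDeriv_one {X : Set L} {x : L} :
    x ∈ leftDeriv X (1 : Ordinal.{u}) ↔ x ∈ X ∧ IsLeftLim X x := by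
  rw [← zero_add (1 : Ordinal.{u}), mem_leftDeriv_add_one, leftDeriv_zero]

theorem mem_leftDeriv_two {X : Set L} {x : L} :
    x ∈ leftDeriv X (2 : Ordinal.{u}) ↔ x ∈ X ∧ IsLeftLim {y | y ∈ X ∧ IsLeftLim X y} x := by
  rw [← one_add_one_eq_two, mem_leftDeriv_add_one]
  have : leftDeriv X (1 : Ordinal.{u}) = {y | y ∈ X ∧ IsLeftLim X y} :=
    Set.ext fun y => mem_leftDeriv_one
  rw [this]

/-- Every `X` whose `γ`-th derivative is nonempty contains `K` points that are pairwise
`A`-related, or a set of pairwise unrelated points whose second derivative is nonempty. -/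
def DerivRamsey (A : L → L → Prop) (γ : Ordinal.{u}) (K : ℕ) : Prop :=
  ∀ (X : Set L) (p : L), p ∈ leftDeriv X γ →
    (∀ l : List L, (∀ x ∈ l, x ∈ X) → l.Pairwise A → l.length ≠ K) →
    ∃ X' ⊆ X, (∀ x ∈ X', ∀ y ∈ X', x ≠ y → ¬ A x y) ∧
      ∃ q, q ∈ leftDeriv X' (2 : Ordinal.{u})

theorem derivRamsey_two (A : L → L → Prop) : DerivRamsey A (2 : Ordinal.{u}) 2 :=
  fun X p hp hK => ⟨X, subset_rfl, fun x hx y hy _ h =>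
    hK [x, y] (by simp [hx, hy]) (by simp [h]) rfl, p, hp⟩

theorem DerivRamsey.step [WellFoundedLT L] [Countable L] {A : L → L → Prop}
    (hA : ∀ x y, A x y → A y x) {γ γ' : Ordinal.{u}} {K : ℕ} (h : DerivRamsey A γ K)
    (hγ : ∀ n : ℕ, γ + n < γ') : DerivRamsey A γ' (K + 1) := by
  intro X p hp hK
  let B : Set L := {x | x ∈ X ∧ x < p ∧ A p x}
  let R : Set L := {x | x ∈ X ∧ x < p ∧ ¬ A p x}
  by_cases hB : ∃ q, q ∈ leftDeriv B γ
  · obtain ⟨q, hq⟩ := hB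
    obtain ⟨X', hX', h'⟩ := h B q hq fun l hl hl' hlen =>
      hK (p :: l) (List.forall_mem_cons.2 ⟨leftDeriv_subset hp, fun x hx => (hl x hx).1⟩)
        (List.pairwise_cons.2 ⟨fun x hx => (hl x hx).2.2, hl'⟩) (by simp [hlen])
    exact ⟨X', hX'.trans fun x hx => hx.1, h'⟩
  · have hR : ∀ n : ℕ, IsLeftLim (leftDeriv R (n : Ordinal.{u})) p := by
      intro n
      -- Rank γ + n + 1 is what the pigeonhole needs to force rank γ in B or rank n in R.
      have hlim := (mem_leftDeriv.1 hp).2 (γ + n + 1) (by simpa [add_assoc] using hγ (n + 1))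
      refine ⟨hlim.1, fun a ha => ?_⟩
      obtain ⟨x, hx, hax, hxp⟩ := hlim.2 a ha
      obtain ⟨y, hay, hyx, hy⟩ := leftDeriv_pigeonhole (B := B) (R := R) x γ n hx
        (fun y hy hyx => by
          by_cases hpy : A p y
          exacts [Or.inl ⟨hy, hyx.trans hxp, hpy⟩, Or.inr ⟨hy, hyx.trans hxp, hpy⟩]) a hax
      rcases hy with hy | hy
      · exact absurd ⟨y, hy⟩ hB
      · exact ⟨y, hy, hay, hyx.trans hxp⟩
    obtain ⟨Y, hYR, hY, hlim⟩ := exists_homogeneous_of_isLeftLim hA (R := R) (K := K + 1)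
      (fun l hl => hK l fun x hx => (hl x hx).1) hR
    refine ⟨insert p Y, insert_subset (leftDeriv_subset hp) (hYR.trans fun x hx => hx.1), ?_, p, ?_⟩
    · rintro x (rfl | hx) y (rfl | hy) hxy
      exacts [absurd rfl hxy, (hYR hy).2.2, fun h => (hYR hx).2.2 (hA _ _ h), hY x hx y hy hxy]
    · refine mem_leftDeriv_two.2 ⟨mem_insert _ _, (hR 0).1, fun a ha => ?_⟩
      obtain ⟨y, hy, hy', hay, hyp⟩ := hlim a ha
      exact ⟨y, ⟨mem_insert_of_mem _ hy, hy'.mono (subset_insert _ _)⟩, hay, hyp⟩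

theorem derivRamsey_omega0_mul [WellFoundedLT L] [Countable L] {A : L → L → Prop}
    (hA : ∀ x y, A x y → A y x) (k : ℕ) :
    DerivRamsey A (ω * ((k + 1 : ℕ) : Ordinal.{u})) (k + 3) := by
  induction k with
  | zero =>
    refine (derivRamsey_two A).step hA fun n => ?_
    simpa using natCast_lt_omega0 (2 + n)
  | succ k ih =>
    refine ih.step hA fun n => ?_
    rw [Nat.cast_succ (k + 1), mul_add, mul_one]
    exact add_lt_add_right (natCast_lt_omega0 n) _

end Induction

/-! ### Ranks of ordinals, and countability -/

section Ordinals

theorem add_omega0_opow_mem_leftDeriv {β : Ordinal.{u}} (α : Ordinal.{u}) :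
    ∀ (γ : Ordinal.{u}) (h : γ + ω ^ α < β),
      (⟨γ + ω ^ α, h⟩ : Iio β) ∈ leftDeriv (univ : Set (Iio β)) α := by
  induction α using WellFoundedLT.induction with
  | _ α ih =>
  intro γ h
  have hpos : ω ^ α ≠ 0 := (opow_pos α omega0_pos).ne'
  have hγ : γ < γ + ω ^ α := lt_add_of_pos_right γ (opow_pos α omega0_pos)
  refine mem_leftDeriv.2 ⟨mem_univ _, fun α' hα' => ⟨⟨⟨γ, hγ.trans h⟩, hγ⟩, ?_⟩⟩
  rintro ⟨a, ha'⟩ ha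
  obtain ⟨d, hd, had⟩ := (lt_add_iff hpos).1 (show a < γ + ω ^ α from ha)
  have hlt : γ + d + ω ^ α' < γ + ω ^ α := by
    rw [add_assoc]
    exact add_lt_add_right (isPrincipal_add_omega0_opow α hd
      ((opow_lt_opow_iff_right one_lt_omega0).2 hα')) γ
  exact ⟨⟨γ + d + ω ^ α', hlt.trans h⟩, ih α' hα' (γ + d) _,
    had.trans_lt (lt_add_of_pos_right _ (opow_pos α' omega0_pos)), hlt⟩

theorem countable_Iio_omega0_opow_add_one {a : Ordinal.{u}} (ha : a.card ≤ Cardinal.aleph0) :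
    Countable (Iio (ω ^ a + 1 : Ordinal.{u})) := by
  rw [← Cardinal.mk_le_aleph0_iff, Cardinal.mk_Iio_ordinal, Cardinal.lift_le_aleph0, card_add,
    card_one]
  refine Cardinal.add_le_aleph0.2 ⟨(card_opow_le _ _).trans ?_, Cardinal.one_le_aleph0⟩
  simp [ha]

theorem countable_Iio_omega0_sq : Countable (Iio (ω ^ (2 : Ordinal.{u}) + 1 : Ordinal.{u})) :=
  countable_Iio_omega0_opow_add_one (by simp)

end Ordinals

/-! ### Closed copies of ω² + 1 from a nonempty second derivative -/

section Copies

theorem IsLeftLim.exists_seq {L : Type*} [LinearOrder L] {S : Set L} (hS : S.Countable) {x : L}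
    (h : IsLeftLim S x) :
    ∃ u : ℕ → L, StrictMono u ∧ (∀ n, u n ∈ S ∧ u n < x) ∧ ∀ a < x, ∃ n, a < u n := by
  obtain ⟨⟨a, ha⟩, h⟩ := h
  have hne : (S ∩ Iio x).Nonempty := (h a ha).imp fun y hy => ⟨hy.1, hy.2.2⟩
  obtain ⟨e, he⟩ := (hS.mono inter_subset_left : (S ∩ Iio x).Countable).exists_eq_range hne
  have he' : ∀ n, e n ∈ S ∩ Iio x := fun n => he ▸ mem_range_self n
  have hex : ∀ (y : ↥(S ∩ Iio x)) (n : ℕ), ∃ z : ↥(S ∩ Iio x), y < z ∧ e n < z := by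
    intro y n
    obtain ⟨z, hz, hz', hzx⟩ := h (max y.1 (e n)) (max_lt y.2.2 (he' n).2)
    rw [max_lt_iff] at hz'
    exact ⟨⟨z, hz, hzx⟩, hz'⟩
  choose g hg hg' using hex
  let v : ℕ → ↥(S ∩ Iio x) := fun n => Nat.rec ⟨e 0, he' 0⟩ (fun n y => g y n) n
  refine ⟨fun n => (v n).1, strictMono_nat_of_lt_succ fun n => hg (v n) n, fun n => (v n).2, ?_⟩
  intro a ha
  obtain ⟨y, hy, hay, hyx⟩ := h a ha
  obtain ⟨n, rfl⟩ : y ∈ range e := he ▸ ⟨hy, hyx⟩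
  exact ⟨n + 1, hay.trans (hg' (v n) n)⟩

/-- The preimage of an upper ray is a final segment with a least element, which by hypothesis is no
left limit; hence it is open. The preimage of a lower ray is an open initial segment. -/
theorem StrictMono.continuous_of_isLeftLim {A B : Type*} [LinearOrder A] [WellFoundedLT A]
    [LinearOrder B] [TopologicalSpace A] [OrderTopology A] [TopologicalSpace B] [OrderTopology B]
    {f : A → B} (hf : StrictMono f)
    (h : ∀ x, IsLeftLim Set.univ x → ∀ b < f x, ∃ y < x, b < f y) : Continuous f := by
  rw [OrderTopology.continuous_iff]
  refine fun b => ⟨?_, ?_⟩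
  · rcases (f ⁻¹' Ioi b).eq_empty_or_nonempty with he | hne
    · rw [he]; exact isOpen_empty
    obtain ⟨x, hx, hmin⟩ := WellFounded.has_min (wellFounded_lt (α := A)) _ hne
    have hIci : f ⁻¹' Ioi b = Ici x := by
      ext y
      exact ⟨fun hy => not_lt.1 (hmin y hy), fun hy => lt_of_lt_of_le hx (hf.monotone hy)⟩
    have hlim : ¬ IsLeftLim univ x := fun hl => by
      obtain ⟨y, hyx, hy⟩ := h x hl b hx
      exact hmin y hy hyx
    rw [hIci]
    simp only [IsLeftLim, not_and_or, not_exists, not_forall, mem_univ, true_and, not_lt] at hlim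
    rcases hlim with hm | ⟨a, ha, hax⟩
    · have : Ici x = Set.univ := eq_univ_of_forall hm
      rw [this]; exact isOpen_univ
    · have : Ici x = Ioi a := by
        ext y
        exact ⟨fun hy => lt_of_lt_of_le ha hy, fun hy => not_lt.1 fun hyx => (hax y).elim hy.not_ge hyx.not_ge⟩
      rw [this]; exact isOpen_Ioi
  · rcases ((f ⁻¹' Iio b)ᶜ).eq_empty_or_nonempty with he | hne
    · rw [compl_empty_iff.1 he]; exact isOpen_univ
    obtain ⟨x, hx, hmin⟩ := WellFounded.has_min (wellFounded_lt (α := A)) _ hne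
    have : f ⁻¹' Iio b = Iio x := by
      ext y
      refine ⟨fun hy => not_le.1 fun hxy => hx ((hf.monotone hxy).trans_lt hy), fun hy => ?_⟩
      by_contra hy'
      exact hmin y hy' hy
    rw [this]; exact isOpen_Iio

theorem isClosedCopy_range {α β : Ordinal.{u}} [CompactSpace (Iio α)] {f : Iio α → Iio β}
    (hf : StrictMono f) (hc : Continuous f) : IsClosedCopy (range f) α := by
  refine ⟨(hf.orderIso f).symm, ?_⟩
  let H := (hc.isClosedEmbedding hf.injective).isEmbedding.toHomeomorph
  have : ⇑(hf.orderIso f).symm = ⇑H.symm := by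
    funext y
    obtain ⟨x, rfl⟩ := H.surjective y
    rw [Homeomorph.symm_apply_apply]
    exact (hf.orderIso f).symm_apply_apply x
  rw [this]
  exact H.symm.isHomeomorph

theorem compactSpace_Iio_add_one (a : Ordinal.{u}) : CompactSpace (Iio (a + 1)) := by
  have : Iio (a + 1) = Icc 0 a := by
    ext x
    simp [Order.lt_add_one_iff]
  rw [this]
  infer_instance

theorem exists_omega0_mul_add_of_lt_sq {x : Ordinal.{u}} (hx : x < ω ^ (2 : Ordinal.{u})) :
    ∃ i m : ℕ, x = ω * i + m := by
  have h1 : x / ω < ω := by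
    rw [← lt_mul_iff_div_lt omega0_ne_zero, ← pow_two]
    exact_mod_cast hx
  obtain ⟨i, hi⟩ := lt_omega0.1 h1
  obtain ⟨m, hm⟩ := lt_omega0.1 (mod_lt x omega0_ne_zero)
  exact ⟨i, m, by rw [← hi, ← hm, div_add_mod]⟩

theorem omega0_mul_add_lt_of_lt {i j m n : ℕ} (h : i < j) :
    (ω * i + m : Ordinal.{u}) < ω * j + n := by
  calc (ω * i + m : Ordinal.{u}) < ω * i + ω := add_lt_add_right (natCast_lt_omega0 m) _
    _ = ω * ((i + 1 : ℕ) : Ordinal.{u}) := by rw [Nat.cast_succ, mul_add, mul_one]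
    _ ≤ ω * j := mul_le_mul_right (by exact_mod_cast h) _
    _ ≤ _ := le_self_add

theorem omega0_mul_add_lt_sq (i m : ℕ) : (ω * i + m : Ordinal.{u}) < ω ^ (2 : Ordinal.{u}) := by
  have h : (ω ^ (2 : Ordinal.{u}) : Ordinal.{u}) = ω * ω := by
    rw [← pow_two]; exact_mod_cast rfl
  calc (ω * i + m : Ordinal.{u}) < ω * ((i + 1 : ℕ) : Ordinal.{u}) + (0 : ℕ) :=
        omega0_mul_add_lt_of_lt i.lt_succ_self
    _ ≤ ω * ω := by
        rw [Nat.cast_zero, add_zero]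
        exact mul_le_mul_right (natCast_lt_omega0 _).le _
    _ = _ := h.symm

theorem exists_isClosedCopy_of_mem_leftDeriv {β : Ordinal.{u}} {X : Set (Iio β)}
    (hX : X.Countable) {p : Iio β} (hp : p ∈ leftDeriv X (2 : Ordinal.{u})) :
    ∃ X' ⊆ X, IsClosedCopy X' (ω ^ (2 : Ordinal.{u}) + 1) := by
  rw [mem_leftDeriv_two] at hp
  obtain ⟨q, hq, hqX, hqp⟩ := hp.2.exists_seq (hX.mono fun y hy => hy.1)
  have hlim : ∀ i, IsLeftLim (X ∩ Ioi (q i)) (q (i + 1)) := fun i =>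
    ⟨⟨q i, hq i.lt_succ_self⟩, fun a ha => by
      obtain ⟨y, hy, hay, hyq⟩ := (hqX (i + 1)).1.2.2 (max a (q i)) (max_lt ha (hq i.lt_succ_self))
      rw [max_lt_iff] at hay
      exact ⟨y, ⟨hy, hay.2⟩, hay.1, hyq⟩⟩
  choose v hv hvX hvq using fun i => (hlim i).exists_seq (hX.mono inter_subset_left)
  -- Row i starts at `q i` and climbs to `q (i + 1)`, the start of the next row, so `w i m` can be
  -- the image of ω·i + m.
  let w : ℕ → ℕ → Iio β := fun i m => Nat.casesOn m (q i) (v i)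
  have hw0 : ∀ i, w i 0 = q i := fun i => rfl
  have hwX : ∀ i m, w i m ∈ X := fun i m => by
    cases m with
    | zero => exact (hqX i).1.1
    | succ m => exact (hvX i m).1.1
  have hw : ∀ i, StrictMono (w i) := fun i => strictMono_nat_of_lt_succ fun m => by
    cases m with
    | zero => exact (hvX i 0).1.2
    | succ m => exact hv i m.lt_succ_self
  have hwq : ∀ i m, w i m < q (i + 1) := fun i m => by
    cases m with
    | zero => exact hq i.lt_succ_self
    | succ m => exact (hvX i m).2
  have hww : ∀ i j m n, i < j → w i m < w j n := fun i j m n hij =>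
    (hwq i m).trans_le ((hq.monotone hij).trans ((hw0 j).symm.le.trans ((hw j).monotone n.zero_le)))
  classical
  let f : Iio (ω ^ (2 : Ordinal.{u}) + 1 : Ordinal.{u}) → Iio β := fun x =>
    if x.1 < ω ^ (2 : Ordinal.{u}) then
      w (Cardinal.toNat (x.1 / ω).card) (Cardinal.toNat (x.1 % ω).card) else p
  have hfw : ∀ (i m : ℕ) h, f ⟨ω * i + m, h⟩ = w i m := fun i m h => by
    have h1 : (ω * i + m : Ordinal.{u}) / ω = i := by
      rw [mul_add_div _ omega0_ne_zero, div_eq_zero_of_lt (natCast_lt_omega0 m), add_zero]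
    have h2 : (ω * i + m : Ordinal.{u}) % ω = m := by
      rw [mul_add_mod_self, mod_eq_of_lt (natCast_lt_omega0 m)]
    simp only [f, omega0_mul_add_lt_sq, if_true, h1, h2, card_nat, Cardinal.toNat_natCast]
  have hfp : ∀ h, f ⟨ω ^ (2 : Ordinal.{u}), h⟩ = p := fun h => by
    simp only [f, lt_irrefl, if_false]
  have hcases : ∀ x : Iio (ω ^ (2 : Ordinal.{u}) + 1 : Ordinal.{u}),
      x.1 = ω ^ (2 : Ordinal.{u}) ∨ ∃ i m : ℕ, x.1 = ω * i + m := fun x =>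
    (Order.lt_add_one_iff.1 x.2).eq_or_lt.imp id exists_omega0_mul_add_of_lt_sq
  have hf : StrictMono f := by
    rintro ⟨x, hx⟩ ⟨y, hy⟩ hxy
    replace hxy : x < y := hxy
    rcases hcases ⟨x, hx⟩ with h | ⟨i, m, h⟩ <;> dsimp only at h <;> subst h
    · exact absurd hy (Order.lt_add_one_iff.not.2 hxy.not_ge)
    rcases hcases ⟨y, hy⟩ with h | ⟨j, n, h⟩ <;> dsimp only at h <;> subst h
    · rw [hfw, hfp]
      exact (hwq i m).trans (hqX (i + 1)).2
    · rw [hfw, hfw]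
      rcases lt_trichotomy i j with hij | rfl | hij
      · exact hww i j m n hij
      · exact hw i (by exact_mod_cast (add_lt_add_iff_left _).1 hxy)
      · exact absurd hxy (omega0_mul_add_lt_of_lt hij).not_gt
  have hfc : Continuous f := by
    refine hf.continuous_of_isLeftLim ?_
    rintro ⟨x, hx⟩ hl b hb
    have hlt : ∀ i m : ℕ, (ω * i + m : Ordinal.{u}) < ω ^ (2 : Ordinal.{u}) + 1 := fun i m =>
      (omega0_mul_add_lt_sq i m).trans (lt_add_one _)
    rcases hcases ⟨x, hx⟩ with h | ⟨i, m, h⟩ <;> dsimp only at h <;> subst h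
    · rw [hfp] at hb
      obtain ⟨i, hi⟩ := hqp b hb
      refine ⟨⟨ω * i + (0 : ℕ), hlt _ _⟩, omega0_mul_add_lt_sq i 0, ?_⟩
      rwa [hfw i 0 (hlt _ _)]
    rw [hfw] at hb
    rcases m with _ | m
    · rcases i with _ | i
      · obtain ⟨a, ha⟩ := hl.1
        exact absurd (show a.1 < _ from ha) (by simp)
      · obtain ⟨m, hm⟩ := hvq i b hb
        refine ⟨⟨ω * i + (m + 1 : ℕ), hlt _ _⟩, omega0_mul_add_lt_of_lt i.lt_succ_self, ?_⟩
        rwa [hfw i (m + 1) (hlt _ _)]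
    · obtain ⟨y, -, hy1, hy2⟩ := hl.2 ⟨ω * i + m, hlt i m⟩
        (show (ω * i + m : Ordinal.{u}) < ω * i + (m + 1 : ℕ) from
          add_lt_add_right (by exact_mod_cast m.lt_succ_self) _)
      replace hy1 : (ω * i + m : Ordinal.{u}) < y.1 := hy1
      replace hy2 : y.1 < ω * i + (m + 1 : ℕ) := hy2
      rw [Nat.cast_succ, ← add_assoc, Order.lt_add_one_iff] at hy2
      exact absurd hy1 hy2.not_gt
  have := compactSpace_Iio_add_one (ω ^ (2 : Ordinal.{u}))
  refine ⟨range f, ?_, isClosedCopy_range hf hfc⟩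
  rintro _ ⟨⟨x, hx⟩, rfl⟩
  rcases hcases ⟨x, hx⟩ with h | ⟨i, m, h⟩ <;> dsimp only at h <;> subst h
  · rw [hfp]
    exact hp.1
  · rw [hfw]
    exact hwX i m

end Copies

/-! ### Equivalence of the topological and closed relations -/

section Transport

open Topology

theorem IsLeftLim.accPt {L : Type*} [LinearOrder L] [TopologicalSpace L] [OrderTopology L]
    {S : Set L} {x : L} (h : IsLeftLim S x) : AccPt x (𝓟 S) := by
  rw [accPt_iff_nhds]
  intro U hU
  obtain ⟨a, ha, haU⟩ := exists_Ioc_subset_of_mem_nhds hU h.1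
  obtain ⟨y, hy, hay, hyx⟩ := h.2 a ha
  exact ⟨y, ⟨haU ⟨hay, hyx.le⟩, hy⟩, hyx.ne⟩

/-- The points below x + 1 form a neighbourhood of x, so ordinals accumulate only from the left.
Thus left limits are topological and survive homeomorphisms. -/
theorem isLeftLim_image_val_of_accPt {β : Ordinal.{u}} {X : Set (Iio β)} {S : Set X} {x : X}
    (h : AccPt x (𝓟 S)) : IsLeftLim (Subtype.val '' S) x.1 := by
  rw [accPt_iff_nhds] at h
  have hval : Continuous fun y : X => y.1.1 := continuous_subtype_val.comp continuous_subtype_val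
  have hx : ∀ᶠ y : X in 𝓝 x, y.1.1 < x.1.1 + 1 :=
    (isOpen_Iio.preimage hval).mem_nhds (lt_add_one x.1.1)
  have hlt : ∀ y : X, y.1.1 < x.1.1 + 1 → y ≠ x → y.1 < x.1 := fun y h1 h2 =>
    lt_of_le_of_ne (show y.1.1 ≤ x.1.1 from Order.lt_add_one_iff.1 h1) (Subtype.coe_injective.ne h2)
  refine ⟨?_, fun a ha => ?_⟩
  · obtain ⟨y, ⟨hy, -⟩, hyx⟩ := h _ hx
    exact ⟨y.1, hlt y hy hyx⟩
  · have ha' : ∀ᶠ y : X in 𝓝 x, a < y.1 :=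
      (isOpen_Ioi.preimage continuous_subtype_val).mem_nhds ha
    obtain ⟨y, ⟨⟨hy, hay⟩, hyS⟩, hyx⟩ := h _ (inter_mem hx ha')
    exact ⟨y.1, mem_image_of_mem _ hyS, hay, hlt y hy hyx⟩

theorem IsLeftLim.of_homeomorph {α β : Ordinal.{u}} {X : Set (Iio β)} (h : X ≃ₜ Iio α)
    {T : Set (Iio α)} {z : Iio α} (hz : IsLeftLim T z) :
    IsLeftLim (Subtype.val '' (h ⁻¹' T)) (h.symm z).1 := by
  refine isLeftLim_image_val_of_accPt (accPt_iff_nhds.2 fun U hU => ?_)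
  obtain ⟨y, ⟨hyU, hyT⟩, hyz⟩ := accPt_iff_nhds.1 hz.accPt (h.symm ⁻¹' U)
    (h.symm.continuous.continuousAt.preimage_mem_nhds hU)
  exact ⟨h.symm y, ⟨hyU, by simpa using hyT⟩, h.symm.injective.ne hyz⟩

theorem exists_isClosedCopy_of_isTopCopy {β : Ordinal.{u}} {X : Set (Iio β)}
    (hX : IsTopCopy X (ω ^ (2 : Ordinal.{u}) + 1)) :
    ∃ X' ⊆ X, IsClosedCopy X' (ω ^ (2 : Ordinal.{u}) + 1) := by
  obtain ⟨h⟩ := hX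
  have := countable_Iio_omega0_sq.{u}
  have hXc : X.Countable := h.injective.countable
  have hp := add_omega0_opow_mem_leftDeriv (β := ω ^ (2 : Ordinal.{u}) + 1) (2 : Ordinal.{u}) 0
    (by rw [zero_add]; exact lt_add_one _)
  have hsub : ∀ T : Set X, Subtype.val '' T ⊆ X := fun T => by
    rintro _ ⟨y, -, rfl⟩
    exact y.2
  refine exists_isClosedCopy_of_mem_leftDeriv hXc (p := (h.symm ⟨_, _⟩).1)
    (mem_leftDeriv_two.2 ⟨(h.symm _).2, (((mem_leftDeriv_two.1 hp).2.of_homeomorph h).mono ?_)⟩)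
  rintro _ ⟨y, hy, rfl⟩
  refine ⟨y.2, ?_⟩
  have := (hy.2.of_homeomorph h).mono (hsub _)
  rwa [h.symm_apply_apply] at this

theorem isClosedCopy_natCast {β : Ordinal.{u}} {X : Set (Iio β)} [Finite X] {n : ℕ}
    (hn : Nat.card X = n) : IsClosedCopy X (n : Ordinal.{u}) := by
  have hcard : Cardinal.mk (Iio (n : Ordinal.{u})) = n := by simp [Cardinal.mk_Iio_ordinal]
  have : Finite (Iio (n : Ordinal.{u})) :=
    Cardinal.lt_aleph0_iff_finite.1 (hcard ▸ Cardinal.natCast_lt_aleph0)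
  have := Fintype.ofFinite X
  have := Fintype.ofFinite (Iio (n : Ordinal.{u}))
  have h1 : Fintype.card X = n := by rw [← hn, Nat.card_eq_fintype_card]
  have h2 : Fintype.card (Iio (n : Ordinal.{u})) = n := by
    rw [← Nat.card_eq_fintype_card, Nat.card, hcard, Cardinal.toNat_natCast]
  let e := (monoEquivOfFin X h1).symm.trans (monoEquivOfFin (Iio (n : Ordinal.{u})) h2)
  exact ⟨e, continuous_of_discreteTopology, fun s _ => isOpen_discrete _, e.bijective⟩

theorem isClosedCopy_natCast_of_isTopCopy {β : Ordinal.{u}} {X : Set (Iio β)} {n : ℕ}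
    (hX : IsTopCopy X (n : Ordinal.{u})) : IsClosedCopy X (n : Ordinal.{u}) := by
  obtain ⟨h⟩ := hX
  have hcard : Cardinal.mk (Iio (n : Ordinal.{u})) = n := by simp [Cardinal.mk_Iio_ordinal]
  have : Finite (Iio (n : Ordinal.{u})) :=
    Cardinal.lt_aleph0_iff_finite.1 (hcard ▸ Cardinal.natCast_lt_aleph0)
  have : Finite X := Finite.of_equiv _ h.symm.toEquiv
  refine isClosedCopy_natCast ?_
  rw [Nat.card_congr h.toEquiv, Nat.card, hcard, Cardinal.toNat_natCast]

theorem IsClosedCopy.isTopCopy {β α : Ordinal.{u}} {X : Set (Iio β)} (h : IsClosedCopy X α) :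
    IsTopCopy X α := by
  obtain ⟨e, he⟩ := h
  exact ⟨he.homeomorph⟩

theorem IsHomogeneousFor.mono {β : Ordinal.{u}} {n : ℕ} {ι : Type*}
    {c : Set.powersetCard (Iio β) n → ι} {i : ι} {X Y : Set (Iio β)}
    (hX : IsHomogeneousFor c i X) (hYX : Y ⊆ X) : IsHomogeneousFor c i Y :=
  fun s hs => hX s (hs.trans hYX)

theorem arrowTop_iff_arrowCl {β : Ordinal.{u}} {n : ℕ} :
    ArrowTop β 2 ![(ω : Ordinal.{u}) ^ (2 : Ordinal.{u}) + 1, (n : Ordinal.{u})] ↔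
      ArrowCl β 2 ![(ω : Ordinal.{u}) ^ (2 : Ordinal.{u}) + 1, (n : Ordinal.{u})] := by
  refine ⟨fun h c => ?_, fun h c => ?_⟩
  · obtain ⟨X, i, hi, hX⟩ := h c
    match i with
    | 0 =>
      obtain ⟨X', hX', hcl⟩ := exists_isClosedCopy_of_isTopCopy hX
      exact ⟨X', 0, hi.mono hX', hcl⟩
    | 1 => exact ⟨X, 1, hi, isClosedCopy_natCast_of_isTopCopy hX⟩
  · obtain ⟨X, i, hi, hX⟩ := h c
    exact ⟨X, i, hi, hX.isTopCopy⟩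

end Transport

/-! ### Conclusion for ω^(ω·k) + 1 -/

section Main

theorem isHomogeneousFor_two {β : Ordinal.{u}} {ι : Type*} {c : Set.powersetCard (Iio β) 2 → ι}
    {i : ι} {X : Set (Iio β)}
    (h : ∀ x ∈ X, ∀ y ∈ X, ∀ hxy : x ≠ y, c ⟨{x, y}, Finset.card_pair hxy⟩ = i) :
    IsHomogeneousFor c i X := by
  rintro ⟨s, hs⟩ hsX
  obtain ⟨x, y, hxy, rfl⟩ := Finset.card_eq_two.1 hs
  exact h x (hsX (by simp)) y (hsX (by simp)) hxy

theorem arrowCl_omega0_opow (k : ℕ) (hk : 0 < k) :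
    ArrowCl ((ω : Ordinal.{u}) ^ (ω * (k : Ordinal.{u})) + 1) 2
      ![(ω : Ordinal.{u}) ^ (2 : Ordinal.{u}) + 1, ((k + 2 : ℕ) : Ordinal.{u})] := by
  obtain ⟨k, rfl⟩ := Nat.exists_eq_add_of_lt hk
  rw [zero_add]
  intro c
  have hcount : Countable (Iio ((ω : Ordinal.{u}) ^ (ω * ((k + 1 : ℕ) : Ordinal.{u})) + 1)) := by
    refine countable_Iio_omega0_opow_add_one ?_
    rw [card_mul, card_omega0, card_nat]
    exact (mul_le_mul_right Cardinal.natCast_le_aleph0 _).trans_eq Cardinal.aleph0_mul_aleph0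
  let A : Iio ((ω : Ordinal.{u}) ^ (ω * ((k + 1 : ℕ) : Ordinal.{u})) + 1) →
      Iio ((ω : Ordinal.{u}) ^ (ω * ((k + 1 : ℕ) : Ordinal.{u})) + 1) → Prop :=
    fun x y => ∃ h : x ≠ y, c ⟨{x, y}, Finset.card_pair h⟩ = 1
  have hA : ∀ x y, A x y → A y x := by
    rintro x y ⟨h, hc⟩
    refine ⟨h.symm, hc ▸ ?_⟩
    congr 2
    exact Finset.pair_comm y x
  -- Here k is the original value minus one, so k + 3 is the required clique size.
  by_cases hl : ∃ l : List (Iio _), l.Pairwise A ∧ l.length = k + 3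
  · obtain ⟨l, hl, hlen⟩ := hl
    have hnodup : l.Nodup := hl.imp fun h => h.1
    refine ⟨{x | x ∈ l}, 1, isHomogeneousFor_two fun x hx y hy hxy => ?_, ?_⟩
    · have : Std.Symm A := ⟨hA⟩
      exact (hl.forall hx hy hxy).2
    · have hset : {x | x ∈ l} = (l.toFinset : Set _) := by ext; simp
      have : Finite {x | x ∈ l} := l.finite_toSet
      refine isClosedCopy_natCast (n := k + 1 + 2) ?_
      rw [Nat.card_coe_set_eq, hset, Set.ncard_coe_finset, List.toFinset_card_of_nodup hnodup, hlen]
  · push Not at hl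
    have hp := add_omega0_opow_mem_leftDeriv
      (β := (ω : Ordinal.{u}) ^ (ω * ((k + 1 : ℕ) : Ordinal.{u})) + 1)
      (ω * ((k + 1 : ℕ) : Ordinal.{u})) 0 (by rw [zero_add]; exact lt_add_one _)
    obtain ⟨X, -, hX, q, hq⟩ := derivRamsey_omega0_mul hA k _ _ hp fun l _ h => hl l h
    obtain ⟨X', hX', hcl⟩ := exists_isClosedCopy_of_mem_leftDeriv X.to_countable hq
    refine ⟨X', 0, isHomogeneousFor_two fun x hx y hy hxy => ?_, hcl⟩
    have := hX x (hX' hx) y (hX' hy) hxy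
    by_contra h0
    exact this ⟨hxy, Fin.eq_one_of_ne_zero _ h0⟩

end Main

theorem mainTheorem8 (k : ℕ) (hk : 0 < k) :
    ArrowCl ((ω : Ordinal.{u}) ^ (ω * (k : Ordinal.{u})) + 1) 2
      ![(ω : Ordinal.{u}) ^ (2 : Ordinal.{u}) + 1, ((k + 2 : ℕ) : Ordinal.{u})] ∧
    IsLeast {β : Ordinal.{u} | ArrowTop β 2
        ![(ω : Ordinal.{u}) ^ (2 : Ordinal.{u}) + 1, ((k + 2 : ℕ) : Ordinal.{u})]}
      (topRamsey ![(ω : Ordinal.{u}) ^ (2 : Ordinal.{u}) + 1, ((k + 2 : ℕ) : Ordinal.{u})]) ∧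
    IsLeast {β : Ordinal.{u} | ArrowCl β 2
        ![(ω : Ordinal.{u}) ^ (2 : Ordinal.{u}) + 1, ((k + 2 : ℕ) : Ordinal.{u})]}
      (closedRamsey ![(ω : Ordinal.{u}) ^ (2 : Ordinal.{u}) + 1, ((k + 2 : ℕ) : Ordinal.{u})]) ∧
    topRamsey ![(ω : Ordinal.{u}) ^ (2 : Ordinal.{u}) + 1, ((k + 2 : ℕ) : Ordinal.{u})] =
      closedRamsey ![(ω : Ordinal.{u}) ^ (2 : Ordinal.{u}) + 1, ((k + 2 : ℕ) : Ordinal.{u})] ∧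
    closedRamsey ![(ω : Ordinal.{u}) ^ (2 : Ordinal.{u}) + 1, ((k + 2 : ℕ) : Ordinal.{u})] ≤
      (ω : Ordinal.{u}) ^ (ω * (k : Ordinal.{u})) + 1 := by
  have hcl := arrowCl_omega0_opow.{u} k hk
  have hset : {β : Ordinal.{u} | ArrowTop β 2
        ![(ω : Ordinal.{u}) ^ (2 : Ordinal.{u}) + 1, ((k + 2 : ℕ) : Ordinal.{u})]} =
      {β : Ordinal.{u} | ArrowCl β 2
        ![(ω : Ordinal.{u}) ^ (2 : Ordinal.{u}) + 1, ((k + 2 : ℕ) : Ordinal.{u})]} :=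
    Set.ext fun β => arrowTop_iff_arrowCl
  have hleast : ∀ S : Set Ordinal.{u}, S.Nonempty → IsLeast S (sInf S) := fun S hS =>
    ⟨csInf_mem hS, fun x hx => csInf_le' hx⟩
  exact ⟨hcl, hleast _ ⟨_, arrowTop_iff_arrowCl.2 hcl⟩, hleast _ ⟨_, hcl⟩, congrArg sInf hset,
    csInf_le' hcl⟩
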